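/- Let $W=(W_t)_{t\ge 0}$ be a standard Wiener process on a probability space $(\Omega,\mathcal B,\mathbb P)$, let $\xi$ be a real random variable independent of the process $W$ with $\mathbb P(0\le\xi<\infty)=1$, and let $k\ge 0$. Put $X_t=\xi+W_t$ and let $$\tau=\inf\{t>0:\ \xi+W_t<kt\}\qquad(\inf\emptyset=\infty)$$ be the first hitting time of the line $b(t)=kt$. Write $\hat g(s)=\mathbb E[e^{-s\xi}]$ and $\hat f(s)=\mathbb E[e^{-s\tau}]$ for $s\ge 0$, where $e^{-s\tau}$ is read as $0$ on $\{\tau=\infty\}$ (for $s=0$ too). Then $$\hat g(s)=\hat f\left(sk+\frac{s^2}{2}\right)\qquad\text{for all } s\ge 0.$$ Moreover, if $F$ is a probability distribution on $[0,\infty)$ and $\xi$ solves the problem of realizing $F$ as the hitting time distribution, that is, $\mathbb P(\tau\le t)=F(t)$ for all $t\ge 0$, then $\hat f(u)=\int_{[0,\infty)}e^{-ut}\,dF(t)$ for all $u\ge 0$, and therefore $$\hat g(s)=\int_{[0,\infty)}e^{-(sk+s^2/2)t}\,dF(t)\qquad\text{for all } s\ge 0.$$ -/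

import Mathlib

open MeasureTheory ProbabilityTheory
open scoped NNReal ENNReal

noncomputable section

/-- First time `t > 0` at which the path `x` is strictly below the boundary `b`:
`inf {t : t > 0, x t < b t}`, with value `∞` if there is no such time. -/
def firstHittingTime (x b : ℝ≥0 → ℝ) : ℝ≥0∞ :=
  sInf ((fun t : ℝ≥0 => (t : ℝ≥0∞)) '' {t : ℝ≥0 | 0 < t ∧ x t < b t})

/-- First hitting time of the line `t ↦ k t` by the process `t ↦ ξ + W t`. -/
def lineHittingTime {Ω : Type*} (W : ℝ≥0 → Ω → ℝ) (ξ : Ω → ℝ) (k : ℝ) (ω : Ω) : ℝ≥0∞ :=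
  firstHittingTime (fun t => ξ ω + W t ω) (fun t => k * (t : ℝ))

/-- `e^{-s t}` for a time `t ∈ [0, ∞]`, with the value `0` at `t = ∞` (for every `s`). -/
def expNegTime (s : ℝ) (t : ℝ≥0∞) : ℝ :=
  if t = ∞ then 0 else Real.exp (-(s * t.toReal))

/-- `E[e^{-s τ}]` for a random time `τ` with values in `[0, ∞]`;
the event `τ = ∞` does not contribute. -/
def laplaceTime {Ω : Type*} [MeasurableSpace Ω] (P : Measure Ω) (τ : Ω → ℝ≥0∞) (s : ℝ) : ℝ :=
  ∫ ω, expNegTime s (τ ω) ∂P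

/-- `E[e^{-s ξ}]` for a real random variable `ξ`. -/
def laplaceVar {Ω : Type*} [MeasurableSpace Ω] (P : Measure Ω) (ξ : Ω → ℝ) (s : ℝ) : ℝ :=
  ∫ ω, Real.exp (-(s * ξ ω)) ∂P

/-- `∫₀^∞ e^{-s t} dF(t)` for a distribution `F` on `[0, ∞)`. -/
def laplaceDist (F : Measure ℝ≥0) (s : ℝ) : ℝ :=
  ∫ t, Real.exp (-(s * (t : ℝ))) ∂F

/-- `ξ` solves the problem with target distribution `F` and slope `k`: the hitting time of the
line `t ↦ k t` by `ξ + W` satisfies `P(τ ≤ t) = F(t)` for every `t ≥ 0`. -/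
def SolvesHittingProblem {Ω : Type*} [MeasurableSpace Ω] (P : Measure Ω) (W : ℝ≥0 → Ω → ℝ)
    (k : ℝ) (F : Measure ℝ≥0) (ξ : Ω → ℝ) : Prop :=
  ∀ t : ℝ≥0, P {ω | lineHittingTime W ξ k ω ≤ (t : ℝ≥0∞)} = F (Set.Iic t)

end

section

open Filter Topology Set

/-! The Wald martingale `exp (-s W_t - s² t / 2)` has mean one. For a fixed start `x ≥ 0` the path
stays on or above the line up to `τ` and meets it at a finite `τ`. Hence the martingale is at most
`exp (s x - (s k + s²/2) t)` for `t ≤ τ`, with equality at a finite `τ`. Stopping at `min τ T` and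
letting `T → ∞` gives `1 = e^{s x} E e^{-(s k + s²/2) τ}` for `s > 0`, the paths with `τ = ∞`
contributing nothing in the limit; `s = 0` follows by continuity. Independence and Fubini then
integrate this over the law of `ξ`.

Optional stopping is done by hand: a finite induction on the grid of mesh `T / (n + 1)`, then `n →
∞`. The grid time may overshoot the line, so the stopped values are not bounded uniformly; a
second-moment bound replaces domination (`integral_eq_of_tendsto_of_integral_sq_le`). -/

/-! ### Hitting times of continuous paths and their discretization -/

theorem firstHittingTime_le {x b : ℝ≥0 → ℝ} {t : ℝ≥0} (ht : 0 < t) (h : x t < b t) :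
    firstHittingTime x b ≤ t :=
  sInf_le ⟨t, ⟨ht, h⟩, rfl⟩

theorem exists_of_firstHittingTime_lt {x b : ℝ≥0 → ℝ} {c : ℝ≥0∞}
    (h : firstHittingTime x b < c) : ∃ t : ℝ≥0, 0 < t ∧ x t < b t ∧ (t : ℝ≥0∞) < c := by
  obtain ⟨_, ⟨t, ⟨ht, hx⟩, rfl⟩, hc⟩ := sInf_lt_iff.1 h
  exact ⟨t, ht, hx, hc⟩

theorem exists_forall_Ico_lt {x b : ℝ≥0 → ℝ} (hx : Continuous x) (hb : Continuous b) {t : ℝ≥0}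
    (h : x t < b t) : ∃ c > t, ∀ r, t ≤ r → r < c → x r < b r := by
  have hev : ∀ᶠ r in 𝓝 t, x r < b r := hx.continuousAt.eventually_lt hb.continuousAt h
  obtain ⟨c, hc, hsub⟩ := exists_Ico_subset_of_mem_nhds hev (exists_gt t)
  exact ⟨c, hc, fun r h1 h2 => hsub ⟨h1, h2⟩⟩

theorem boundary_le_of_le_firstHittingTime {x b : ℝ≥0 → ℝ} (hx : Continuous x)
    (hb : Continuous b) (h0 : b 0 ≤ x 0) {t : ℝ≥0} (ht : (t : ℝ≥0∞) ≤ firstHittingTime x b) :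
    b t ≤ x t := by
  by_contra! h
  have hpos : 0 < t := by
    rcases eq_zero_or_pos t with rfl | h'
    · exact absurd h0 (not_le.2 h)
    · exact h'
  have hev : ∀ᶠ r in 𝓝 t, x r < b r := hx.continuousAt.eventually_lt hb.continuousAt h
  obtain ⟨l, hl, hsub⟩ := exists_Ioc_subset_of_mem_nhds hev ⟨0, hpos⟩
  obtain ⟨r, hlr, hrt⟩ := exists_between hl
  have := firstHittingTime_le (bot_le.trans_lt hlr) (hsub ⟨hlr, hrt.le⟩)
  exact absurd (ht.trans this) (not_le.2 (by exact_mod_cast hrt))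

theorem le_boundary_firstHittingTime {x b : ℝ≥0 → ℝ} (hx : Continuous x) (hb : Continuous b)
    {t : ℝ≥0} (ht : firstHittingTime x b = t) : x t ≤ b t := by
  by_contra! h
  obtain ⟨c, hc, hlt⟩ := exists_forall_Ico_lt hb hx h
  obtain ⟨r, hr, hxr, hrc⟩ := exists_of_firstHittingTime_lt (x := x) (b := b) (c := c)
    (by rw [ht]; exact_mod_cast hc)
  have := firstHittingTime_le hr hxr
  rw [ht] at this
  exact (hlt r (by exact_mod_cast this) (by exact_mod_cast hrc)).not_gt hxr

/-- The first index at which `H` holds, capped at `i`. -/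
noncomputable def cappedFirstIndex (H : ℕ → Prop) (i : ℕ) : ℕ := sInf {j | j = i ∨ H j}

theorem cappedFirstIndex_spec (H : ℕ → Prop) (i : ℕ) :
    cappedFirstIndex H i = i ∨ H (cappedFirstIndex H i) :=
  Nat.sInf_mem (s := {j | j = i ∨ H j}) ⟨i, Or.inl rfl⟩

theorem cappedFirstIndex_le (H : ℕ → Prop) (i : ℕ) : cappedFirstIndex H i ≤ i :=
  Nat.sInf_le (Or.inl rfl)

theorem cappedFirstIndex_le_of_holds {H : ℕ → Prop} (i : ℕ) {j : ℕ} (h : H j) :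
    cappedFirstIndex H i ≤ j :=
  Nat.sInf_le (Or.inr h)

theorem cappedFirstIndex_eq_self {H : ℕ → Prop} {i : ℕ} (h : ∀ j < i, ¬ H j) :
    cappedFirstIndex H i = i := by
  rcases cappedFirstIndex_spec H i with h' | h'
  · exact h'
  · exact (cappedFirstIndex_le H i).antisymm (not_lt.1 fun hlt => h _ hlt h')

theorem cappedFirstIndex_succ {H : ℕ → Prop} {i : ℕ} (h : ∃ j ≤ i, H j) :
    cappedFirstIndex H (i + 1) = cappedFirstIndex H i := by
  obtain ⟨j, hj, hH⟩ := h
  apply le_antisymm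
  · rcases cappedFirstIndex_spec H i with h' | h'
    · rw [h']
      exact (cappedFirstIndex_le_of_holds _ hH).trans hj
    · exact cappedFirstIndex_le_of_holds _ h'
  · rcases cappedFirstIndex_spec H (i + 1) with h' | h'
    · have := cappedFirstIndex_le_of_holds (i + 1) hH
      omega
    · exact cappedFirstIndex_le_of_holds _ h'

/-- A crossing on the grid is a true crossing, so the grid time is never too early. A strict
crossing persists on an interval to its right, which contains a grid point once the mesh is small,
so it is not late in the limit. -/
theorem tendsto_discretized_firstHittingTime {x b : ℝ≥0 → ℝ} (hx : Continuous x)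
    (hb : Continuous b) {T : ℝ≥0} (hT : 0 < T) :
    Tendsto (fun n : ℕ => (cappedFirstIndex (fun j => 0 < j ∧
        x (j * (T / (n + 1))) < b (j * (T / (n + 1)))) (n + 1) : ℝ≥0) * (T / (n + 1)))
      atTop (𝓝 (min (firstHittingTime x b) T).toNNReal) := by
  set ρ := (min (firstHittingTime x b) T).toNNReal with hρ
  have hρc : (ρ : ℝ≥0∞) = min (firstHittingTime x b) T :=
    ENNReal.coe_toNNReal (ne_top_of_le_ne_top ENNReal.coe_ne_top (min_le_right _ _))
  have hδ (n : ℕ) : 0 < T / ((n : ℝ≥0) + 1) := by positivity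
  have hTn (n : ℕ) : ((n + 1 : ℕ) : ℝ≥0) * (T / (n + 1)) = T := by
    push_cast
    field_simp
  refine tendsto_order.2 ⟨fun a ha => Eventually.of_forall fun n => ha.trans_le ?_, fun a ha => ?_⟩
  · rw [← ENNReal.coe_le_coe, hρc]
    rcases cappedFirstIndex_spec (fun j => 0 < j ∧
        x (j * (T / (n + 1))) < b (j * (T / (n + 1)))) (n + 1) with h | h
    · rw [h, hTn]
      exact min_le_right _ _
    · refine (min_le_left _ _).trans (firstHittingTime_le ?_ h.2)
      exact mul_pos (by exact_mod_cast h.1) (hδ n)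
  · rcases le_or_gt (T : ℝ≥0∞) (firstHittingTime x b) with h | h
    · rw [min_eq_right h] at hρc
      have hρT : ρ = T := by exact_mod_cast hρc
      refine Eventually.of_forall fun n => lt_of_le_of_lt ?_ ha
      rw [hρT]
      calc _ ≤ ((n + 1 : ℕ) : ℝ≥0) * (T / (n + 1)) := by
            gcongr
            exact cappedFirstIndex_le _ _
        _ = T := hTn n
    · rw [min_eq_left h.le] at hρc
      obtain ⟨t, ht, hxt, hta⟩ := exists_of_firstHittingTime_lt (x := x) (b := b) (c := a)
        (by rw [← hρc]; exact_mod_cast ha)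
      obtain ⟨c, hc, hlt⟩ := exists_forall_Ico_lt hx hb hxt
      have hlim : Tendsto (fun n : ℕ => t + T / ((n : ℝ≥0) + 1)) atTop (𝓝 t) := by
        have h1 : Tendsto (fun n : ℕ => T * (1 / ((n : ℝ≥0) + 1))) atTop (𝓝 (T * 0)) :=
          (tendsto_one_div_add_atTop_nhds_zero_nat (𝕜 := ℝ≥0)).const_mul T
        simpa [div_eq_mul_inv] using h1.const_add t
      have hta' : t < min c a := lt_min hc (by exact_mod_cast hta)
      filter_upwards [hlim.eventually (gt_mem_nhds hta')] with n hn
      set δ := T / ((n : ℝ≥0) + 1) with hδn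
      have hδp : 0 < δ := hδ n
      have h1 : t ≤ (⌈t / δ⌉₊ : ℝ≥0) * δ := by
        rw [← div_le_iff₀ hδp]
        exact Nat.le_ceil _
      have h2 : (⌈t / δ⌉₊ : ℝ≥0) * δ < t + δ := by
        have := Nat.ceil_lt_add_one (a := t / δ) bot_le
        calc (⌈t / δ⌉₊ : ℝ≥0) * δ < (t / δ + 1) * δ := by gcongr
          _ = t + δ := by field_simp
      have h3 := h2.trans hn
      refine lt_of_le_of_lt ?_ (h3.trans_le (min_le_right _ _))
      gcongr
      -- The index may exceed the cap `n + 1`; the bound holds all the same.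
      refine cappedFirstIndex_le_of_holds _ ⟨?_, hlt _ h1 (h3.trans_le (min_le_left _ _))⟩
      exact Nat.ceil_pos.2 (div_pos ht hδp)

/-- Strict crossings form an open set, so rational times suffice; this makes `τ` measurable in
countably many coordinates. -/
theorem firstHittingTime_eq_iInf_nnrat {x b : ℝ≥0 → ℝ} (hx : Continuous x) (hb : Continuous b) :
    firstHittingTime x b =
      ⨅ q : ℚ≥0, if 0 < q ∧ x q < b q then ((q : ℝ≥0) : ℝ≥0∞) else ∞ := by
  apply le_antisymm
  · refine le_iInf fun q => ?_
    split_ifs with h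
    · exact firstHittingTime_le (by exact_mod_cast h.1) h.2
    · exact le_top
  · refine le_of_forall_gt fun c hc => ?_
    obtain ⟨t, ht, hxt, htc⟩ := exists_of_firstHittingTime_lt hc
    obtain ⟨d, hd, hlt⟩ := exists_forall_Ico_lt hx hb hxt
    obtain ⟨e, hte, hec⟩ := ENNReal.lt_iff_exists_nnreal_btwn.1 htc
    obtain ⟨q, hq1, hq2⟩ : ∃ q : ℚ≥0, t < q ∧ (q : ℝ≥0) < min d e := by
      have hte' : t < min d e := lt_min hd (by exact_mod_cast hte)
      obtain ⟨q, h1, h2⟩ := exists_rat_btwn (show (t : ℝ) < (min d e : ℝ≥0) by exact_mod_cast hte')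
      have hq : 0 ≤ q := by
        have : (0 : ℝ) ≤ q := t.2.trans h1.le
        exact_mod_cast this
      lift q to ℚ≥0 using hq
      exact ⟨q, by exact_mod_cast h1, by exact_mod_cast h2⟩
    refine (iInf_le _ q).trans_lt ?_
    rw [if_pos ⟨by exact_mod_cast ht.trans hq1, hlt _ hq1.le (hq2.trans_le (min_le_left _ _))⟩]
    exact lt_trans (by exact_mod_cast hq2.trans_le (min_le_right _ _)) hec

/-- Uniform integrability from the second moment: `Y ≤ min Y K + Y² / K`, so truncating at `K` loses
at most `C / K`, and truncation at `K ≥ B` does not affect the limit. -/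
theorem integral_eq_of_tendsto_of_integral_sq_le {Ω : Type*} [MeasurableSpace Ω] {P : Measure Ω}
    [IsFiniteMeasure P] {Y : ℕ → Ω → ℝ} {Z : Ω → ℝ} {c C B : ℝ}
    (hY : ∀ n, Integrable (Y n) P) (hY2 : ∀ n, Integrable (fun ω => Y n ω ^ 2) P)
    (h0 : ∀ n ω, 0 ≤ Y n ω) (hc : ∀ n, ∫ ω, Y n ω ∂P = c) (hC : ∀ n, ∫ ω, Y n ω ^ 2 ∂P ≤ C)
    (hlim : ∀ᵐ ω ∂P, Tendsto (fun n => Y n ω) atTop (𝓝 (Z ω))) (hB : ∀ᵐ ω ∂P, Z ω ≤ B) :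
    ∫ ω, Z ω ∂P = c := by
  have key (K : ℝ) (hK : 0 < K) (hBK : B ≤ K) :
      ∫ ω, Z ω ∂P ≤ c ∧ c - C / K ≤ ∫ ω, Z ω ∂P := by
    have hint (n : ℕ) : Integrable (fun ω => min (Y n ω) K) P :=
      (hY n).inf (integrable_const K)
    have ht : Tendsto (fun n => ∫ ω, min (Y n ω) K ∂P) atTop (𝓝 (∫ ω, Z ω ∂P)) := by
      refine tendsto_integral_of_dominated_convergence (fun _ => K) (fun n => (hint n).1)
        (integrable_const K) (fun n => Eventually.of_forall fun ω => ?_) ?_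
      · rw [Real.norm_eq_abs, abs_of_nonneg (le_min (h0 n ω) hK.le)]
        exact min_le_right _ _
      · filter_upwards [hlim, hB] with ω h1 h2
        have := h1.min (tendsto_const_nhds (x := K))
        rwa [min_eq_left (h2.trans hBK)] at this
    refine ⟨le_of_tendsto' ht fun n => ?_, ge_of_tendsto' ht fun n => ?_⟩
    · rw [← hc n]
      exact integral_mono (hint n) (hY n) fun ω => min_le_left _ _
    · have h1 : ∫ ω, Y n ω ∂P ≤ ∫ ω, (min (Y n ω) K + Y n ω ^ 2 / K) ∂P := by
        refine integral_mono (hY n) ((hint n).add ((hY2 n).div_const K)) fun ω => ?_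
        show Y n ω ≤ min (Y n ω) K + Y n ω ^ 2 / K
        rcases le_total (Y n ω) K with h | h
        · rw [min_eq_left h]
          have : 0 ≤ Y n ω ^ 2 / K := by positivity
          linarith
        · have : Y n ω ≤ Y n ω ^ 2 / K := by
            rw [le_div_iff₀ hK]
            nlinarith [h0 n ω]
          have := le_min (h0 n ω) hK.le
          linarith
      rw [integral_add (hint n) ((hY2 n).div_const K), integral_div, hc n] at h1
      have : (∫ ω, Y n ω ^ 2 ∂P) / K ≤ C / K := by
        gcongr
        exact hC n
      linarith
  refine le_antisymm (key (max B 1) (by positivity) (le_max_left _ _)).1 ?_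
  have ht : Tendsto (fun K : ℝ => c - C / K) atTop (𝓝 (c - 0)) :=
    (tendsto_const_nhds.div_atTop tendsto_id).const_sub c
  rw [sub_zero] at ht
  refine le_of_tendsto ht ?_
  filter_upwards [eventually_ge_atTop (max B 1)] with K hK
  exact (key K (by linarith [le_max_right B 1]) ((le_max_left _ _).trans hK)).2

/-- The exponential (Wald) martingale `exp (-s wₜ - s² t / 2)` along a path `w`. -/
noncomputable def waldExp (s : ℝ) (w : ℝ≥0 → ℝ) (t : ℝ≥0) : ℝ :=
  Real.exp (-s * w t - s ^ 2 / 2 * t)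

/-! ### Optional stopping of the Wald martingale at discrete times -/

section Brownian

variable {Ω : Type*} [MeasurableSpace Ω] {P : Measure Ω} {W : ℝ≥0 → Ω → ℝ}

theorem ProbabilityTheory.IsPreBrownianReal.integrable_waldExp (hW : IsPreBrownianReal W P) (s : ℝ) (t : ℝ≥0) :
    Integrable (fun ω => waldExp s (W · ω) t) P := by
  have h : Integrable (fun x => Real.exp (-s * x)) (P.map (W t)) := by
    rw [(hW.hasLaw_eval t).map_eq]
    exact integrable_exp_mul_gaussianReal _
  have h' := (h.comp_aemeasurable (hW.aemeasurable t)).mul_const (Real.exp (-(s ^ 2 / 2 * t)))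
  refine h'.congr (Eventually.of_forall fun ω => ?_)
  simp only [Function.comp, waldExp, ← Real.exp_add]
  ring_nf

theorem ProbabilityTheory.IsPreBrownianReal.integral_waldExp (hW : IsPreBrownianReal W P) (s : ℝ) (t : ℝ≥0) :
    ∫ ω, waldExp s (W · ω) t ∂P = 1 := by
  have h := mgf_gaussianReal (hW.hasLaw_eval t).map_eq (-s)
  rw [mgf] at h
  calc ∫ ω, waldExp s (W · ω) t ∂P
      = ∫ ω, Real.exp (-s * W t ω) * Real.exp (-(s ^ 2 / 2 * t)) ∂P := by
        refine integral_congr_ae (Eventually.of_forall fun ω => ?_)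
        simp only [waldExp, ← Real.exp_add]
        ring_nf
    _ = 1 := by
        rw [integral_mul_const, h, ← Real.exp_add, Real.exp_eq_one_iff]
        ring

theorem measurableSet_exists_le_mem {t : ℕ → ℝ≥0} (ht : Monotone t) {S : ℕ → Set ℝ}
    (hS : ∀ j, MeasurableSet (S j)) (i : ℕ) :
    MeasurableSet {w : Set.Iic (t i) → ℝ | ∃ j, ∃ h : j ≤ i, w ⟨t j, ht h⟩ ∈ S j} := by
  have : {w : Set.Iic (t i) → ℝ | ∃ j, ∃ h : j ≤ i, w ⟨t j, ht h⟩ ∈ S j} =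
      ⋃ j, ⋃ h : j ≤ i, (fun w : Set.Iic (t i) → ℝ => w ⟨t j, ht h⟩) ⁻¹' S j := by
    ext w
    simp
  rw [this]
  exact MeasurableSet.iUnion fun j => MeasurableSet.iUnion fun h => measurable_pi_apply _ (hS j)

/-- The increment factors as (martingale at `t i`, killed if already stopped) times (Wald
exponential of the shifted path minus one). The first depends on the past, the second is independent
of it and centred. -/
theorem ProbabilityTheory.IsPreBrownianReal.integrable_and_integral_waldExp_increment
    (hW : IsPreBrownianReal W P) (s : ℝ) {t : ℕ → ℝ≥0} (ht : Monotone t) {S : ℕ → Set ℝ}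
    (hS : ∀ j, MeasurableSet (S j)) (i : ℕ) (D : Ω → ℝ)
    (hD1 : ∀ ω, (∃ j ≤ i, W (t j) ω ∈ S j) → D ω = 0)
    (hD2 : ∀ ω, (¬ ∃ j ≤ i, W (t j) ω ∈ S j) →
      D ω = waldExp s (W · ω) (t (i + 1)) - waldExp s (W · ω) (t i)) :
    Integrable D P ∧ ∫ ω, D ω ∂P = 0 := by
  classical
  have : IsProbabilityMeasure P := hW.isGaussianProcess.isProbabilityMeasure
  have hle : t i ≤ t (i + 1) := ht (Nat.le_succ i)
  set r := t (i + 1) - t i with hr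
  have htr : t i + r = t (i + 1) := add_tsub_cancel_of_le hle
  have hV := hW.shift (t i)
  set past : Ω → Set.Iic (t i) → ℝ := fun ω u => W u ω with hpast
  set A := {w : Set.Iic (t i) → ℝ | ∃ j, ∃ h : j ≤ i, w ⟨t j, ht h⟩ ∈ S j} with hA
  have hAm : MeasurableSet A := measurableSet_exists_le_mem ht hS i
  set φ : (Set.Iic (t i) → ℝ) → ℝ := fun w =>
    Aᶜ.indicator (fun w => Real.exp (-s * w ⟨t i, Set.mem_Iic.2 le_rfl⟩ - s ^ 2 / 2 * t i)) w with hφ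
  have hφm : Measurable φ := by
    refine Measurable.indicator ?_ hAm.compl
    fun_prop
  set ψ : (ℝ≥0 → ℝ) → ℝ := fun v => waldExp s v r - 1 with hψ
  have hψm : Measurable ψ := by
    simp only [hψ, waldExp]
    fun_prop
  set V : Ω → ℝ≥0 → ℝ := fun ω u => W (t i + u) ω - W (t i) ω with hVdef
  have hind : IndepFun (fun ω => ψ (V ω)) (fun ω => φ (past ω)) P :=
    (hW.indepFun_shift (t i)).comp hψm hφm
  have hmem (ω : Ω) : past ω ∈ A ↔ ∃ j ≤ i, W (t j) ω ∈ S j := by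
    simp [hA, hpast]
  have hφ1 (ω : Ω) (h : ∃ j ≤ i, W (t j) ω ∈ S j) : φ (past ω) = 0 :=
    Set.indicator_of_notMem (s := Aᶜ) (fun h' => h' ((hmem ω).2 h)) _
  have hφ2 (ω : Ω) (h : ¬ ∃ j ≤ i, W (t j) ω ∈ S j) :
      φ (past ω) = waldExp s (W · ω) (t i) :=
    Set.indicator_of_mem (s := Aᶜ) (fun h' => h ((hmem ω).1 h')) _
  have hDeq : D = fun ω => ψ (V ω) * φ (past ω) := by
    funext ω
    by_cases h : ∃ j ≤ i, W (t j) ω ∈ S j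
    · rw [hφ1 ω h, hD1 ω h, mul_zero]
    · rw [hφ2 ω h, hD2 ω h]
      simp only [hψ, hVdef, waldExp, htr, sub_mul, one_mul, ← Real.exp_add]
      congr 2
      rw [← htr]
      push_cast
      ring
  have hψi : Integrable (fun ω => ψ (V ω)) P :=
    (IsPreBrownianReal.integrable_waldExp hV s r).sub (integrable_const 1)
  have hψ0 : ∫ ω, ψ (V ω) ∂P = 0 := by
    have h1 := IsPreBrownianReal.integral_waldExp hV s r
    have h2 := integral_sub (IsPreBrownianReal.integrable_waldExp hV s r)
      (integrable_const (1 : ℝ) (μ := P))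
    simp only [hψ, hVdef]
    rw [h2, h1]
    simp
  -- Each `W u` is only a.e. measurable and `past` has uncountably many coordinates, so
  -- measurability is read off the countably many that `φ` uses.
  have hpm : AEMeasurable (fun ω => φ (past ω)) P := by
    have hset : NullMeasurableSet {ω | ∃ j ≤ i, W (t j) ω ∈ S j} P := by
      have : {ω | ∃ j ≤ i, W (t j) ω ∈ S j} = ⋃ j, ⋃ _ : j ≤ i, W (t j) ⁻¹' S j := by
        ext ω
        simp
      rw [this]
      exact .iUnion fun j => .iUnion fun _ => (hW.aemeasurable _).nullMeasurable (hS j)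
    have heq : (fun ω => φ (past ω)) =
        {ω | ∃ j ≤ i, W (t j) ω ∈ S j}ᶜ.indicator (fun ω => waldExp s (W · ω) (t i)) := by
      funext ω
      by_cases h : ∃ j ≤ i, W (t j) ω ∈ S j
      · rw [hφ1 ω h, Set.indicator_of_notMem]
        exact fun h' => h' h
      · rw [hφ2 ω h, Set.indicator_of_mem]
        exact h
    rw [heq]
    exact (IsPreBrownianReal.integrable_waldExp hW s (t i)).1.aemeasurable.indicator₀ hset.compl
  have hφi : Integrable (fun ω => φ (past ω)) P := by
    refine (IsPreBrownianReal.integrable_waldExp hW s (t i)).mono hpm.aestronglyMeasurable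
      (Eventually.of_forall fun ω => ?_)
    exact norm_indicator_le_norm_self _ _
  rw [hDeq]
  refine ⟨hind.integrable_mul hψi hφi, ?_⟩
  have := hind.integral_mul_eq_mul_integral hψi.1 hφi.1
  simp only [Pi.mul_def] at this
  rw [this, hψ0, zero_mul]

/-- Optional stopping of the Wald martingale at the first of finitely many times at which
the path is in a prescribed set. -/
theorem ProbabilityTheory.IsPreBrownianReal.integrable_and_integral_stopped_waldExp
    (hW : IsPreBrownianReal W P) (s : ℝ) {t : ℕ → ℝ≥0} (ht : Monotone t) {S : ℕ → Set ℝ}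
    (hS : ∀ j, MeasurableSet (S j)) (i : ℕ) :
    Integrable (fun ω => waldExp s (W · ω)
      (t (cappedFirstIndex (fun j => W (t j) ω ∈ S j) i))) P ∧
    ∫ ω, waldExp s (W · ω) (t (cappedFirstIndex (fun j => W (t j) ω ∈ S j) i)) ∂P = 1 := by
  induction i with
  | zero =>
    have h (ω : Ω) : cappedFirstIndex (fun j => W (t j) ω ∈ S j) 0 = 0 :=
      Nat.le_zero.1 (cappedFirstIndex_le _ _)
    simp only [h]
    exact ⟨IsPreBrownianReal.integrable_waldExp hW s _, IsPreBrownianReal.integral_waldExp hW s _⟩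
  | succ i ih =>
    set Z : ℕ → Ω → ℝ := fun i ω => waldExp s (W · ω)
      (t (cappedFirstIndex (fun j => W (t j) ω ∈ S j) i)) with hZ
    obtain ⟨h1, h2⟩ := IsPreBrownianReal.integrable_and_integral_waldExp_increment hW s ht hS i
      (fun ω => Z (i + 1) ω - Z i ω) (fun ω h => by simp only [hZ, cappedFirstIndex_succ h, sub_self])
      (fun ω h => by
        push Not at h
        simp only [hZ]
        rw [cappedFirstIndex_eq_self fun j hj => h j (by omega),
          cappedFirstIndex_eq_self fun j hj => h j (by omega)])
    have heq : Z (i + 1) = fun ω => (Z (i + 1) ω - Z i ω) + Z i ω := by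
      funext ω
      ring
    have hi : Integrable (Z (i + 1)) P := by
      rw [heq]
      exact h1.add ih.1
    refine ⟨hi, ?_⟩
    change ∫ ω, Z (i + 1) ω ∂P = 1
    rw [heq, integral_add h1 ih.1, h2, zero_add]
    exact ih.2

end Brownian

/-! ### Continuous-time stopping and the Laplace transform of the hitting time -/

section Brownian

variable {Ω : Type*} [MeasurableSpace Ω] {P : Measure Ω} {W : ℝ≥0 → Ω → ℝ}

theorem continuous_waldExp (s : ℝ) {w : ℝ≥0 → ℝ} (hw : Continuous w) :
    Continuous (waldExp s w) := by
  unfold waldExp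
  fun_prop

/-- Reduces the second moment to optional stopping with parameter `2 s`, whose mean is again one. -/
theorem waldExp_sq (s : ℝ) (w : ℝ≥0 → ℝ) (t : ℝ≥0) :
    waldExp s w t ^ 2 = Real.exp (s ^ 2 * t) * waldExp (2 * s) w t := by
  simp only [waldExp, ← Real.exp_add, ← Real.exp_nat_mul]
  congr 1
  push_cast
  ring

theorem waldExp_le_of_line_le {s x k : ℝ} (hs : 0 ≤ s) {w : ℝ≥0 → ℝ} {t : ℝ≥0}
    (h : k * t ≤ x + w t) :
    waldExp s w t ≤ Real.exp (s * x - (s * k + s ^ 2 / 2) * t) := by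
  refine Real.exp_le_exp.2 ?_
  nlinarith [mul_le_mul_of_nonneg_left h hs]

theorem waldExp_eq_of_line_eq {s x k : ℝ} {w : ℝ≥0 → ℝ} {t : ℝ≥0} (h : x + w t = k * t) :
    waldExp s w t = Real.exp (s * x - (s * k + s ^ 2 / 2) * t) := by
  rw [waldExp, show w t = k * t - x by linarith]
  ring_nf

theorem ProbabilityTheory.IsBrownianReal.integral_stopped_waldExp (hW : IsBrownianReal W P) {s x k : ℝ}
    (hs : 0 ≤ s) (hx : 0 ≤ x) (hk : 0 ≤ k) {T : ℝ≥0} (hT : 0 < T) :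
    ∫ ω, waldExp s (W · ω) (min (lineHittingTime W (fun _ => x) k ω) T).toNNReal ∂P = 1 := by
  have : IsProbabilityMeasure P := hW.isGaussianProcess.isProbabilityMeasure
  set t : ℕ → ℕ → ℝ≥0 := fun n j => j * (T / (n + 1)) with ht
  have htm (n : ℕ) : Monotone (t n) := fun i j hij => by
    simp only [ht]
    gcongr
  have htT (n : ℕ) : t n (n + 1) = T := by
    simp only [ht]
    push_cast
    field_simp
  -- Index `0` is excluded because the hitting time only counts `t > 0`.
  set S : ℕ → ℕ → Set ℝ := fun n j => {y | 0 < j ∧ x + y < k * t n j} with hS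
  have hSm (n j : ℕ) : MeasurableSet (S n j) := by
    exact (MeasurableSet.const _).inter
      (measurableSet_lt (measurable_const.add measurable_id) measurable_const)
  set ρ : ℕ → Ω → ℝ≥0 := fun n ω =>
    t n (cappedFirstIndex (fun j => W (t n j) ω ∈ S n j) (n + 1)) with hρ
  have hρT (n : ℕ) (ω : Ω) : ρ n ω ≤ T := by
    rw [← htT n]
    exact htm n (cappedFirstIndex_le _ _)
  have hopt (r : ℝ) (n : ℕ) : Integrable (fun ω => waldExp r (W · ω) (ρ n ω)) P ∧
      ∫ ω, waldExp r (W · ω) (ρ n ω) ∂P = 1 :=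
    IsPreBrownianReal.integrable_and_integral_stopped_waldExp hW.toIsPreBrownianReal r (htm n)
      (hSm n) (n + 1)
  have hsq (n : ℕ) (ω : Ω) : waldExp s (W · ω) (ρ n ω) ^ 2 ≤
      Real.exp (s ^ 2 * T) * waldExp (2 * s) (W · ω) (ρ n ω) := by
    rw [waldExp_sq]
    have h1 : ((ρ n ω : ℝ≥0) : ℝ) ≤ T := by exact_mod_cast hρT n ω
    have h2 : 0 ≤ waldExp (2 * s) (W · ω) (ρ n ω) := (Real.exp_pos _).le
    gcongr
  have hsqi (n : ℕ) : Integrable (fun ω => waldExp s (W · ω) (ρ n ω) ^ 2) P := by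
    refine ((hopt (2 * s) n).1.const_mul (Real.exp (s ^ 2 * T))).mono'
      ((hopt s n).1.1.pow 2) (Eventually.of_forall fun ω => ?_)
    rw [Real.norm_eq_abs, abs_of_nonneg (sq_nonneg _)]
    exact hsq n ω
  refine integral_eq_of_tendsto_of_integral_sq_le (Y := fun n ω => waldExp s (W · ω) (ρ n ω))
    (C := Real.exp (s ^ 2 * T)) (B := Real.exp (s * x)) (fun n => (hopt s n).1) hsqi
    (fun n ω => (Real.exp_pos _).le) (fun n => (hopt s n).2) (fun n => ?_) ?_ ?_
  · refine (integral_mono (hsqi n) ((hopt (2 * s) n).1.const_mul _) (hsq n)).trans ?_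
    rw [integral_const_mul, (hopt (2 * s) n).2, mul_one]
  · filter_upwards [hW.cont] with ω hω
    have h1 := tendsto_discretized_firstHittingTime (x := fun r => x + W r ω)
      (b := fun r : ℝ≥0 => k * (r : ℝ)) (by fun_prop) (by fun_prop) hT
    exact ((continuous_waldExp s hω).tendsto _).comp h1
  · filter_upwards [hW.cont, hW.eval_zero_ae_eq_zero] with ω hω hω0
    have hle : (((min (lineHittingTime W (fun _ => x) k ω) T).toNNReal : ℝ≥0) : ℝ≥0∞) ≤
        lineHittingTime W (fun _ => x) k ω :=
      ENNReal.coe_toNNReal_le_self.trans (min_le_left _ _)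
    have h := boundary_le_of_le_firstHittingTime (x := fun r => x + W r ω)
      (b := fun r : ℝ≥0 => k * (r : ℝ)) (by fun_prop) (by fun_prop) (by simp [hω0, hx]) hle
    refine (waldExp_le_of_line_le hs h).trans (Real.exp_le_exp.2 ?_)
    have : 0 ≤ (s * k + s ^ 2 / 2) *
      ((min (lineHittingTime W (fun _ => x) k ω) T).toNNReal : ℝ) := by positivity
    linarith

/-- If `τ = ∞`, the bound above the line decays exponentially, which needs `s > 0`; if `τ < ∞`, the
sequence is eventually constant, with its value computed on the line. -/
theorem tendsto_stopped_waldExp {s x k : ℝ} (hs : 0 < s) (hx : 0 ≤ x) (hk : 0 ≤ k)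
    {w : ℝ≥0 → ℝ} (hw : Continuous w) (hw0 : w 0 = 0) :
    Tendsto (fun n : ℕ => waldExp s w (min (firstHittingTime (fun t => x + w t)
        (fun t => k * (t : ℝ))) ((n + 1 : ℝ≥0) : ℝ≥0∞)).toNNReal) atTop
      (𝓝 (Real.exp (s * x) * expNegTime (s * k + s ^ 2 / 2)
        (firstHittingTime (fun t => x + w t) (fun t => k * (t : ℝ))))) := by
  set τ := firstHittingTime (fun t => x + w t) (fun t => k * (t : ℝ)) with hτ
  have hxc : Continuous fun t => x + w t := by fun_prop
  have hbc : Continuous fun t : ℝ≥0 => k * (t : ℝ) := by fun_prop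
  have hge {t : ℝ≥0} (ht : (t : ℝ≥0∞) ≤ τ) : k * t ≤ x + w t :=
    boundary_le_of_le_firstHittingTime hxc hbc (by simp [hw0, hx]) ht
  have hu : 0 < s * k + s ^ 2 / 2 := by positivity
  rcases eq_or_ne τ ∞ with h | h
  · rw [h, expNegTime, if_pos rfl, mul_zero]
    have hlim : Tendsto (fun n : ℕ => Real.exp (s * x - (s * k + s ^ 2 / 2) * ((n : ℝ) + 1)))
        atTop (𝓝 0) := by
      refine Real.tendsto_exp_atBot.comp ?_
      refine tendsto_atBot_add_const_left _ (s * x) (tendsto_neg_atTop_atBot.comp ?_)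
      exact (tendsto_atTop_add_const_right _ 1 tendsto_natCast_atTop_atTop).const_mul_atTop hu
    refine squeeze_zero (fun n => (Real.exp_pos _).le) (fun n => ?_) hlim
    rw [min_eq_right le_top, ENNReal.toNNReal_coe]
    have := waldExp_le_of_line_le hs.le (hge (t := n + 1) (by simp [h]))
    simpa using this
  · lift τ to ℝ≥0 using h with t ht
    have heq : x + w t = k * t := le_antisymm
      (le_boundary_firstHittingTime hxc hbc ht.symm) (hge le_rfl)
    refine tendsto_const_nhds.congr' ?_
    filter_upwards [eventually_ge_atTop ⌈t⌉₊] with n hn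
    have htn : t ≤ (n : ℝ≥0) + 1 :=
      (Nat.le_ceil t).trans ((Nat.cast_le.2 hn).trans (le_add_of_nonneg_right zero_le_one))
    rw [min_eq_left (by exact_mod_cast htn), ENNReal.toNNReal_coe, waldExp_eq_of_line_eq heq,
      expNegTime, if_neg ENNReal.coe_ne_top, ENNReal.coe_toReal, ← Real.exp_add, sub_eq_add_neg]

/-- The first passage time below the line, computed from the rational times alone. -/
noncomputable def rationalHittingTime (k : ℝ) (z : ℝ × (ℚ≥0 → ℝ)) : ℝ≥0∞ :=
  ⨅ q : ℚ≥0, if 0 < q ∧ z.1 + z.2 q < k * ((q : ℝ≥0) : ℝ) then ((q : ℝ≥0) : ℝ≥0∞) else ∞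

theorem measurable_rationalHittingTime (k : ℝ) : Measurable (rationalHittingTime k) := by
  refine Measurable.iInf fun q => Measurable.ite ?_ measurable_const measurable_const
  have hsum : Measurable fun z : ℝ × (ℚ≥0 → ℝ) => z.1 + z.2 q := by fun_prop
  exact (MeasurableSet.const _).inter (measurableSet_lt hsum measurable_const)

theorem measurable_expNegTime (s : ℝ) : Measurable (expNegTime s) := by
  refine Measurable.ite (measurableSet_singleton _) measurable_const ?_
  fun_prop

theorem expNegTime_nonneg (s : ℝ) (t : ℝ≥0∞) : 0 ≤ expNegTime s t := by
  unfold expNegTime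
  split_ifs
  exacts [le_rfl, (Real.exp_pos _).le]

theorem expNegTime_le_one {s : ℝ} (hs : 0 ≤ s) (t : ℝ≥0∞) : expNegTime s t ≤ 1 := by
  unfold expNegTime
  split_ifs
  · exact zero_le_one
  · refine Real.exp_le_one_iff.2 ?_
    have := mul_nonneg hs t.toReal_nonneg
    linarith

theorem continuous_expNegTime_left (t : ℝ≥0∞) : Continuous fun s => expNegTime s t := by
  unfold expNegTime
  split_ifs <;> fun_prop

theorem ProbabilityTheory.IsBrownianReal.lineHittingTime_ae_eq (hW : IsBrownianReal W P) (ξ : Ω → ℝ) (k : ℝ) :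
    lineHittingTime W ξ k =ᵐ[P] fun ω => rationalHittingTime k (ξ ω, fun q => W q ω) := by
  filter_upwards [hW.cont] with ω hω
  exact firstHittingTime_eq_iInf_nnrat (x := fun t => ξ ω + W t ω)
    (b := fun t : ℝ≥0 => k * (t : ℝ)) (by fun_prop) (by fun_prop)

theorem ProbabilityTheory.IsBrownianReal.aemeasurable_rational (hW : IsBrownianReal W P) :
    AEMeasurable (fun ω (q : ℚ≥0) => W q ω) P :=
  aemeasurable_pi_lambda _ fun _ => hW.aemeasurable _

theorem ProbabilityTheory.IsBrownianReal.aemeasurable_lineHittingTime (hW : IsBrownianReal W P) {ξ : Ω → ℝ}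
    (hξ : AEMeasurable ξ P) (k : ℝ) : AEMeasurable (lineHittingTime W ξ k) P := by
  refine AEMeasurable.congr ?_ (IsBrownianReal.lineHittingTime_ae_eq hW ξ k).symm
  exact (measurable_rationalHittingTime k).comp_aemeasurable
    (hξ.prodMk (IsBrownianReal.aemeasurable_rational hW))

theorem ProbabilityTheory.IsBrownianReal.integrable_expNegTime_lineHittingTime [IsFiniteMeasure P]
    (hW : IsBrownianReal W P) {ξ : Ω → ℝ} (hξ : AEMeasurable ξ P) (k : ℝ) {u : ℝ} (hu : 0 ≤ u) :
    Integrable (fun ω => expNegTime u (lineHittingTime W ξ k ω)) P := by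
  refine (integrable_const (1 : ℝ)).mono' ((measurable_expNegTime u).comp_aemeasurable
    (IsBrownianReal.aemeasurable_lineHittingTime hW hξ k)).aestronglyMeasurable
    (Eventually.of_forall fun ω => ?_)
  rw [Real.norm_eq_abs, abs_of_nonneg (expNegTime_nonneg _ _)]
  exact expNegTime_le_one hu _

/-- Laplace transform of the first passage time of Brownian motion started at `x ≥ 0`
below the line of slope `k`. -/
theorem ProbabilityTheory.IsBrownianReal.laplaceTime_lineHittingTime_const (hW : IsBrownianReal W P) {s x k : ℝ}
    (hs : 0 ≤ s) (hx : 0 ≤ x) (hk : 0 ≤ k) :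
    laplaceTime P (lineHittingTime W (fun _ => x) k) (s * k + s ^ 2 / 2) =
      Real.exp (-(s * x)) := by
  have : IsProbabilityMeasure P := hW.isGaussianProcess.isProbabilityMeasure
  have hpos {s : ℝ} (hs : 0 < s) :
      laplaceTime P (lineHittingTime W (fun _ => x) k) (s * k + s ^ 2 / 2) =
        Real.exp (-(s * x)) := by
    have hmeas := IsBrownianReal.aemeasurable_lineHittingTime hW (aemeasurable_const (b := x)) k
    have hnn (n : ℕ) (ω : Ω) :
        0 ≤ waldExp s (W · ω) (min (lineHittingTime W (fun _ => x) k ω)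
          ((n + 1 : ℝ≥0) : ℝ≥0∞)).toNNReal := (Real.exp_pos _).le
    have hint (n : ℕ) : Integrable (fun ω => waldExp s (W · ω)
        (min (lineHittingTime W (fun _ => x) k ω) ((n + 1 : ℝ≥0) : ℝ≥0∞)).toNNReal) P := by
      -- The Bochner integral of a non-integrable function is `0`, whereas this one is `1`.
      by_contra h
      have h1 := IsBrownianReal.integral_stopped_waldExp hW hs.le hx hk
        (T := (n : ℝ≥0) + 1) (by positivity)
      rw [integral_undef h] at h1
      exact zero_ne_one h1
    have hlim : Tendsto (fun n : ℕ => ∫ ω, waldExp s (W · ω)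
        (min (lineHittingTime W (fun _ => x) k ω) ((n + 1 : ℝ≥0) : ℝ≥0∞)).toNNReal ∂P) atTop
        (𝓝 (∫ ω, Real.exp (s * x) * expNegTime (s * k + s ^ 2 / 2)
          (lineHittingTime W (fun _ => x) k ω) ∂P)) := by
      refine tendsto_integral_of_dominated_convergence (fun _ => Real.exp (s * x))
        (fun n => (hint n).1) (integrable_const _) (fun n => ?_) ?_
      · filter_upwards [hW.cont, hW.eval_zero_ae_eq_zero] with ω hω hω0
        rw [Real.norm_eq_abs, abs_of_nonneg (hnn n ω)]
        have hle := ENNReal.coe_toNNReal_le_self.trans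
          (min_le_left (lineHittingTime W (fun _ => x) k ω) ((n + 1 : ℝ≥0) : ℝ≥0∞))
        have h := boundary_le_of_le_firstHittingTime (x := fun r => x + W r ω)
          (b := fun r : ℝ≥0 => k * (r : ℝ)) (by fun_prop) (by fun_prop) (by simp [hω0, hx]) hle
        refine (waldExp_le_of_line_le hs.le h).trans (Real.exp_le_exp.2 ?_)
        have : 0 ≤ (s * k + s ^ 2 / 2) * ((min (lineHittingTime W (fun _ => x) k ω)
          ((n + 1 : ℝ≥0) : ℝ≥0∞)).toNNReal : ℝ) := by positivity
        linarith
      · filter_upwards [hW.cont, hW.eval_zero_ae_eq_zero] with ω hω hω0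
        exact tendsto_stopped_waldExp hs hx hk hω hω0
    have hone (n : ℕ) := IsBrownianReal.integral_stopped_waldExp hW hs.le hx hk
      (T := (n : ℝ≥0) + 1) (by positivity)
    simp only [hone, integral_const_mul] at hlim
    have := tendsto_nhds_unique hlim tendsto_const_nhds
    rw [laplaceTime, Real.exp_neg]
    exact eq_inv_of_mul_eq_one_right this
  rcases hs.eq_or_lt with rfl | hs
  -- At `s = 0` the claim is that `τ < ∞` almost surely; it is the limit along `s = 1 / (n + 1)`,
  -- since `expNegTime` is continuous in `s` even at `τ = ∞`.
  · have hcont : Tendsto (fun n : ℕ => laplaceTime P (lineHittingTime W (fun _ => x) k)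
        ((1 / ((n : ℝ) + 1)) * k + (1 / ((n : ℝ) + 1)) ^ 2 / 2)) atTop
        (𝓝 (laplaceTime P (lineHittingTime W (fun _ => x) k) (0 * k + 0 ^ 2 / 2))) := by
      have h0 := tendsto_one_div_add_atTop_nhds_zero_nat (𝕜 := ℝ)
      have h1 := (h0.mul_const k).add ((h0.pow 2).div_const 2)
      have hnn (n : ℕ) : 0 ≤ (1 / ((n : ℝ) + 1)) * k + (1 / ((n : ℝ) + 1)) ^ 2 / 2 := by
        positivity
      refine tendsto_integral_of_dominated_convergence (fun _ => 1)
        (fun n => (IsBrownianReal.integrable_expNegTime_lineHittingTime hW aemeasurable_const k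
          (hnn n)).1) (integrable_const _)
        (fun n => Eventually.of_forall fun ω => ?_) (Eventually.of_forall fun ω => ?_)
      · rw [Real.norm_eq_abs, abs_of_nonneg (expNegTime_nonneg _ _)]
        exact expNegTime_le_one (hnn n) _
      · exact ((continuous_expNegTime_left _).tendsto _).comp h1
    have hexp : Tendsto (fun n : ℕ => Real.exp (-(1 / ((n : ℝ) + 1) * x))) atTop
        (𝓝 (Real.exp (-(0 * x)))) :=
      (Real.continuous_exp.tendsto _).comp
        ((tendsto_one_div_add_atTop_nhds_zero_nat (𝕜 := ℝ)).mul_const x).neg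
    refine tendsto_nhds_unique hcont (hexp.congr fun n => ?_)
    exact (hpos (by positivity)).symm
  · exact hpos hs

/-! ### Random starting point and prescribed hitting distribution -/

theorem ProbabilityTheory.IsBrownianReal.laplaceVar_eq_laplaceTime_lineHittingTime (hW : IsBrownianReal W P)
    {ξ : Ω → ℝ} (hξm : AEMeasurable ξ P) (hξ : ∀ᵐ ω ∂P, 0 ≤ ξ ω)
    (hindep : IndepFun ξ (fun ω t => W t ω) P) {k s : ℝ} (hk : 0 ≤ k) (hs : 0 ≤ s) :
    laplaceVar P ξ s = laplaceTime P (lineHittingTime W ξ k) (s * k + s ^ 2 / 2) := by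
  have : IsProbabilityMeasure P := hW.isGaussianProcess.isProbabilityMeasure
  -- Restricting `W` to rational times makes the hitting time jointly measurable in start and path,
  -- as Fubini requires.
  set u := s * k + s ^ 2 / 2 with hu
  have hu0 : 0 ≤ u := by positivity
  have hWm := IsBrownianReal.aemeasurable_rational hW
  have hind : IndepFun ξ (fun ω (q : ℚ≥0) => W q ω) P :=
    hindep.comp (φ := id) (ψ := fun (w : ℝ≥0 → ℝ) (q : ℚ≥0) => w q) measurable_id
      (by fun_prop)
  have hGm : Measurable fun z => expNegTime u (rationalHittingTime k z) :=
    (measurable_expNegTime u).comp (measurable_rationalHittingTime k)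
  have hGi : Integrable (fun z => expNegTime u (rationalHittingTime k z))
      ((P.map ξ).prod (P.map fun ω (q : ℚ≥0) => W q ω)) := by
    have := Measure.isProbabilityMeasure_map hξm
    have := Measure.isProbabilityMeasure_map hWm
    refine (integrable_const (1 : ℝ)).mono' hGm.aestronglyMeasurable
      (Eventually.of_forall fun ω => ?_)
    rw [Real.norm_eq_abs, abs_of_nonneg (expNegTime_nonneg _ _)]
    exact expNegTime_le_one hu0 _
  have hinner (x : ℝ) (hx : 0 ≤ x) :
      ∫ w, expNegTime u (rationalHittingTime k (x, w)) ∂(P.map fun ω (q : ℚ≥0) => W q ω) =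
        Real.exp (-(s * x)) := by
    have hGx : Measurable fun w => expNegTime u (rationalHittingTime k (x, w)) :=
      hGm.comp measurable_prodMk_left
    rw [integral_map hWm hGx.aestronglyMeasurable,
      ← IsBrownianReal.laplaceTime_lineHittingTime_const hW hs hx hk]
    refine integral_congr_ae ?_
    filter_upwards [IsBrownianReal.lineHittingTime_ae_eq hW (fun _ => x) k] with ω hω
    rw [hω]
  calc laplaceVar P ξ s = ∫ x, Real.exp (-(s * x)) ∂(P.map ξ) :=
        (integral_map (f := fun x => Real.exp (-(s * x))) hξm (by fun_prop)).symm
    _ = ∫ x, ∫ w, expNegTime u (rationalHittingTime k (x, w))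
          ∂(P.map fun ω (q : ℚ≥0) => W q ω) ∂(P.map ξ) := by
        refine integral_congr_ae ?_
        filter_upwards [(ae_map_iff hξm measurableSet_Ici).2 hξ] with x hx
        exact (hinner x hx).symm
    _ = ∫ z, expNegTime u (rationalHittingTime k z)
          ∂(P.map fun ω => (ξ ω, fun q : ℚ≥0 => W q ω)) := by
        rw [hind.map_prod_eq_prod_map_map hξm hWm, integral_prod _ hGi]
    _ = ∫ ω, expNegTime u (rationalHittingTime k (ξ ω, fun q : ℚ≥0 => W q ω)) ∂P :=
        integral_map (hξm.prodMk hWm) hGm.aestronglyMeasurable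
    _ = laplaceTime P (lineHittingTime W ξ k) u := by
        refine integral_congr_ae ?_
        filter_upwards [IsBrownianReal.lineHittingTime_ae_eq hW ξ k] with ω hω
        rw [hω]

/-- Both laws are compared on `[0, ∞]` through their distribution functions; since `F` has total
mass one, `τ = ∞` is null. -/
theorem laplaceTime_eq_laplaceDist [IsProbabilityMeasure P] {τ : Ω → ℝ≥0∞}
    (hτ : AEMeasurable τ P) (F : Measure ℝ≥0) [IsProbabilityMeasure F]
    (h : ∀ t : ℝ≥0, P {ω | τ ω ≤ t} = F (Iic t)) (u : ℝ) :
    laplaceTime P τ u = laplaceDist F u := by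
  have hcoe : Measurable ((↑) : ℝ≥0 → ℝ≥0∞) := measurable_coe_nnreal_ennreal
  have := Measure.isProbabilityMeasure_map hτ
  have := Measure.isProbabilityMeasure_map (μ := F) hcoe.aemeasurable
  have hlaw : P.map τ = F.map ((↑) : ℝ≥0 → ℝ≥0∞) := by
    refine Measure.ext_of_Iic _ _ fun a => ?_
    induction a with
    | top => rw [Iic_top, measure_univ, measure_univ]
    | coe t =>
      rw [Measure.map_apply_of_aemeasurable hτ measurableSet_Iic,
        Measure.map_apply hcoe measurableSet_Iic]
      have hpre : ((↑) : ℝ≥0 → ℝ≥0∞) ⁻¹' Iic (t : ℝ≥0∞) = Iic t := by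
        ext r
        exact ENNReal.coe_le_coe
      rw [hpre]
      exact h t
  calc laplaceTime P τ u = ∫ t, expNegTime u t ∂(P.map τ) :=
        (integral_map hτ (measurable_expNegTime u).aestronglyMeasurable).symm
    _ = laplaceDist F u := by
        rw [hlaw, integral_map hcoe.aemeasurable (measurable_expNegTime u).aestronglyMeasurable]
        simp [laplaceDist, expNegTime]

end Brownian

end

theorem theorem1 {Ω : Type*} [MeasurableSpace Ω] (P : Measure Ω) [IsProbabilityMeasure P]
    (W : ℝ≥0 → Ω → ℝ) (hW : IsBrownianReal W P)
    (ξ : Ω → ℝ) (hξm : AEMeasurable ξ P) (hξ : ∀ᵐ ω ∂P, 0 ≤ ξ ω)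
    (hindep : IndepFun ξ (fun ω t => W t ω) P)
    (k : ℝ) (hk : 0 ≤ k) :
    (∀ s : ℝ, 0 ≤ s →
      laplaceVar P ξ s = laplaceTime P (lineHittingTime W ξ k) (s * k + s ^ 2 / 2)) ∧
    ∀ F : Measure ℝ≥0, IsProbabilityMeasure F → SolvesHittingProblem P W k F ξ →
      (∀ u : ℝ, 0 ≤ u → laplaceTime P (lineHittingTime W ξ k) u = laplaceDist F u) ∧
      (∀ s : ℝ, 0 ≤ s → laplaceVar P ξ s = laplaceDist F (s * k + s ^ 2 / 2)) := by
  have hlap (s : ℝ) (hs : 0 ≤ s) :=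
    IsBrownianReal.laplaceVar_eq_laplaceTime_lineHittingTime hW hξm hξ hindep hk hs
  refine ⟨hlap, fun F _ hF => ?_⟩
  have hdist (u : ℝ) := laplaceTime_eq_laplaceDist
    (IsBrownianReal.aemeasurable_lineHittingTime hW hξm k) F hF u
  exact ⟨fun u _ => hdist u, fun s hs => (hlap s hs).trans (hdist _)⟩
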